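/- Let $\mathbb{F}$ be $\mathbb{R}$ or $\mathbb{C}$, let $n\geq 3$, and let $Q_{2n}$ be the $2n$-dimensional nilpotent Lie algebra over $\mathbb{F}$ with basis $X_1,\dots,X_{2n}$ and brackets $$[X_1,X_i]=X_{i+1}\quad(2\leq i\leq 2n-2),\qquad [X_k,X_{2n+1-k}]=(-1)^kX_{2n}\quad(2\leq k\leq n),$$ all other brackets $[X_i,X_j]$ with $i<j$ being zero. Then: (i) Every finite-dimensional solvable, non-nilpotent Lie algebra $\mathfrak{r}$ over $\mathbb{F}$ whose nilradical (largest nilpotent ideal) is isomorphic to $Q_{2n}$ has dimension $2n+1$ or $2n+2$. (ii) There are at most two nil-independent derivations of $Q_{2n}$: if $D_1,\dots,D_m$ are derivations of $Q_{2n}$ such that no linear combination $c_1D_1+\dots+c_mD_m$ with $(c_1,\dots,c_m)\neq(0,\dots,0)$ is nilpotent, then $m\leq 2$. (Such derivations are automatically outer.) -/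

import Mathlib

/-- The underlying space of the Lie algebra `Q_{2n}` over `R`: coordinate vectors with respect to
a basis `X_1, …, X_{2n}`. -/
def QAlg (R : Type*) (n : ℕ) : Type _ := Fin (2 * n) → R

namespace QAlg

instance instAddCommGroup (R : Type*) [CommRing R] (n : ℕ) : AddCommGroup (QAlg R n) :=
  inferInstanceAs (AddCommGroup (Fin (2 * n) → R))

instance instModule (R : Type*) [CommRing R] (n : ℕ) : Module R (QAlg R n) :=
  inferInstanceAs (Module R (Fin (2 * n) → R))

/-- The coefficient of `X_i` in `x` for `1 ≤ i ≤ 2n`, and `0` for all other `i`. -/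
def coord {R : Type*} [CommRing R] {n : ℕ} (x : QAlg R n) (i : ℕ) : R :=
  if h : 1 ≤ i ∧ i ≤ 2 * n then x ⟨i - 1, by omega⟩ else 0

/-- The vector whose coefficient at `X_i` is `f i`, for `1 ≤ i ≤ 2n`. -/
def ofCoord {R : Type*} [CommRing R] {n : ℕ} (f : ℕ → R) : QAlg R n :=
  fun j => f (j.val + 1)

/-- The basis vector `X_i` (for `1 ≤ i ≤ 2n`). -/
def X (R : Type*) [CommRing R] (n : ℕ) (i : ℕ) : QAlg R n :=
  ofCoord (fun m => if m = i then 1 else 0)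

/-- The basis `X_1, …, X_{2n}`, indexed from zero. -/
noncomputable def basis (R : Type*) [CommRing R] (n : ℕ) : Module.Basis (Fin (2 * n)) R (QAlg R n) :=
  Pi.basisFun R (Fin (2 * n))

theorem basis_apply {R : Type*} [CommRing R] {n : ℕ} (j : Fin (2 * n)) :
    basis R n j = X R n (j.val + 1) := by
  refine (Pi.basisFun_apply R (Fin (2 * n)) j).trans (funext fun k => ?_)
  by_cases h : k = j
  · subst h; simp [X, ofCoord]
  · have : ¬ (k.val = j.val) := fun e => h (Fin.ext e)
    simp [X, ofCoord, h, this]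

theorem ext_coord {R : Type*} [CommRing R] {n : ℕ} {x y : QAlg R n}
    (h : ∀ i, 1 ≤ i → i ≤ 2 * n → coord x i = coord y i) : x = y := by
  funext j
  have := h (j.val + 1) (by omega) (by omega)
  have hj : 1 ≤ j.val + 1 ∧ j.val + 1 ≤ 2 * n := by omega
  simpa only [coord, dif_pos hj, Nat.add_sub_cancel] using this

theorem coord_ofCoord {R : Type*} [CommRing R] {n : ℕ} (f : ℕ → R) (i : ℕ) :
    coord (ofCoord f : QAlg R n) i = if 1 ≤ i ∧ i ≤ 2 * n then f i else 0 := by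
  unfold coord ofCoord
  split_ifs with h
  · congr 1; simp only; omega
  · rfl

theorem coord_add {R : Type*} [CommRing R] {n : ℕ} (x y : QAlg R n) (i : ℕ) :
    coord (x + y) i = coord x i + coord y i := by
  unfold coord
  split_ifs
  · rfl
  · simp

theorem coord_smul {R : Type*} [CommRing R] {n : ℕ} (c : R) (x : QAlg R n) (i : ℕ) :
    coord (c • x) i = c * coord x i := by
  unfold coord
  split_ifs
  · rfl
  · simp

theorem coord_zero {R : Type*} [CommRing R] {n : ℕ} (i : ℕ) :
    coord (0 : QAlg R n) i = 0 := by
  unfold coord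
  split_ifs
  · rfl
  · rfl

/-- The coefficients of the bracket of `x = ∑ x_i X_i` and `y = ∑ y_i X_i` in `Q_{2n}`, whose
nonzero brackets of basis vectors are `[X_1, X_i] = X_{i+1}` for `2 ≤ i ≤ 2n - 2` and
`[X_k, X_{2n+1-k}] = (-1)^k X_{2n}` for `2 ≤ k ≤ n`, up to antisymmetry.
As `k ↦ 2n + 1 - k` exchanges `{2, …, n}` and `{n + 1, …, 2n - 1}` and reverses the sign
`(-1)^k`, the latter relation holds for `2 ≤ k ≤ 2n - 1`. -/
def bracketCoord {R : Type*} [CommRing R] {n : ℕ} (x y : QAlg R n) (m : ℕ) : R :=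
  if m = 2 * n then
    ∑ k ∈ Finset.Icc 2 (2 * n - 1), (-1) ^ k * (coord x k * coord y (2 * n + 1 - k))
  else if 3 ≤ m then coord x 1 * coord y (m - 1) - coord x (m - 1) * coord y 1
  else 0

instance instBracket (R : Type*) [CommRing R] (n : ℕ) : Bracket (QAlg R n) (QAlg R n) :=
  ⟨fun x y => ofCoord (bracketCoord x y)⟩

theorem coord_lie {R : Type*} [CommRing R] {n : ℕ} (x y : QAlg R n) (i : ℕ) :
    coord ⁅x, y⁆ i = if 1 ≤ i ∧ i ≤ 2 * n then bracketCoord x y i else 0 :=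
  coord_ofCoord _ _

theorem sum_antisymm {R : Type*} [CommRing R] (n : ℕ) (f g : ℕ → R) :
    ∑ k ∈ Finset.Icc 2 (2 * n - 1), (-1) ^ k * (f k * g (2 * n + 1 - k)) =
      - ∑ k ∈ Finset.Icc 2 (2 * n - 1), (-1) ^ k * (g k * f (2 * n + 1 - k)) := by
  rw [← Finset.sum_neg_distrib]
  refine Finset.sum_nbij' (fun k => 2 * n + 1 - k) (fun k => 2 * n + 1 - k) ?_ ?_ ?_ ?_ ?_
  · intro k hk; simp only [Finset.mem_Icc] at hk ⊢; omega
  · intro k hk; simp only [Finset.mem_Icc] at hk ⊢; omega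
  · intro k hk; simp only [Finset.mem_Icc] at hk; omega
  · intro k hk; simp only [Finset.mem_Icc] at hk; omega
  · intro k hk
    simp only [Finset.mem_Icc] at hk
    have h1 : 2 * n + 1 - (2 * n + 1 - k) = k := by omega
    have h2 : (-1 : R) ^ (2 * n + 1 - k) = - (-1) ^ k := by
      rcases Nat.even_or_odd k with h | h
      · rw [h.neg_one_pow, Odd.neg_one_pow]
        rw [Nat.odd_sub (by omega)]; simp [h]
      · rw [h.neg_one_pow, Even.neg_one_pow (by rw [Nat.even_sub (by omega)]; simp [h])]
        ring
    rw [h1, h2]; ring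

theorem sum_symm {R : Type*} [CommRing R] (n : ℕ) (f g : ℕ → R) :
    ∑ k ∈ Finset.Icc 2 (2 * n - 2), (-1) ^ k * (f k * g (2 * n - k)) =
      ∑ k ∈ Finset.Icc 2 (2 * n - 2), (-1) ^ k * (g k * f (2 * n - k)) := by
  refine Finset.sum_nbij' (fun k => 2 * n - k) (fun k => 2 * n - k) ?_ ?_ ?_ ?_ ?_
  · intro k hk; simp only [Finset.mem_Icc] at hk ⊢; omega
  · intro k hk; simp only [Finset.mem_Icc] at hk ⊢; omega
  · intro k hk; simp only [Finset.mem_Icc] at hk; omega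
  · intro k hk; simp only [Finset.mem_Icc] at hk; omega
  · intro k hk
    simp only [Finset.mem_Icc] at hk
    have h1 : 2 * n - (2 * n - k) = k := by omega
    have h2 : (-1 : R) ^ (2 * n - k) = (-1) ^ k := by
      rcases Nat.even_or_odd k with h | h
      · rw [h.neg_one_pow, Even.neg_one_pow (by rw [Nat.even_sub (by omega)]; simp [h])]
      · rw [h.neg_one_pow, Odd.neg_one_pow]
        obtain ⟨a, ha⟩ := h; exact ⟨n - a - 1, by omega⟩
    rw [h1, h2]; ring

theorem lie_neg_swap {R : Type*} [CommRing R] {n : ℕ} (x y : QAlg R n) (m : ℕ) :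
    bracketCoord x y m = - bracketCoord y x m := by
  unfold bracketCoord
  split_ifs
  · exact sum_antisymm n _ _
  · ring
  · simp

theorem sum_lie {R : Type*} [CommRing R] {n : ℕ} (x y z : QAlg R n) :
    ∑ k ∈ Finset.Icc 2 (2 * n - 1), (-1) ^ k * (coord x k * coord ⁅y, z⁆ (2 * n + 1 - k)) =
      coord y 1 * ∑ k ∈ Finset.Icc 2 (2 * n - 2), (-1) ^ k * (coord x k * coord z (2 * n - k)) -
      coord z 1 *
        ∑ k ∈ Finset.Icc 2 (2 * n - 2), (-1) ^ k * (coord x k * coord y (2 * n - k)) := by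
  rw [Finset.mul_sum, Finset.mul_sum, ← Finset.sum_sub_distrib]
  symm
  refine Finset.sum_subset_zero_on_sdiff
    (Finset.Icc_subset_Icc le_rfl (by omega)) ?_ ?_
  · intro k hk
    simp only [Finset.mem_sdiff, Finset.mem_Icc] at hk
    have hk2 : 2 * n + 1 - k = 2 := by omega
    rw [coord_lie, hk2]
    have : bracketCoord y z 2 = 0 := by
      unfold bracketCoord
      rw [if_neg (by omega), if_neg (by omega)]
    rw [this, ite_self, mul_zero, mul_zero]
  · intro k hk
    simp only [Finset.mem_Icc] at hk
    have e : 2 * n + 1 - k - 1 = 2 * n - k := by omega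
    rw [coord_lie, if_pos (by omega)]
    unfold bracketCoord
    rw [if_neg (by omega), if_pos (by omega), e]
    ring

theorem coord_lie_one {R : Type*} [CommRing R] {n : ℕ} (x y : QAlg R n) :
    coord ⁅x, y⁆ 1 = 0 := by
  rw [coord_lie]
  split_ifs with h
  · unfold bracketCoord
    rw [if_neg (by omega), if_neg (by omega)]
  · rfl

theorem lie_leibniz {R : Type*} [CommRing R] {n : ℕ} (x y z : QAlg R n) :
    ⁅x, ⁅y, z⁆⁆ = ⁅⁅x, y⁆, z⁆ + ⁅y, ⁅x, z⁆⁆ := by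
  apply ext_coord
  intro i hi hi'
  rw [coord_add, coord_lie x, coord_lie ⁅x, y⁆, coord_lie y ⁅x, z⁆]
  simp only [hi, hi', and_self, if_true]
  rw [lie_neg_swap ⁅x, y⁆ z]
  unfold bracketCoord
  split_ifs with h1 h2
  · rw [sum_lie, sum_lie, sum_lie, sum_symm n (coord z) (coord y), sum_symm n (coord z) (coord x),
      sum_symm n (coord y) (coord x)]
    ring
  · have key : ∀ a b : QAlg R n, coord ⁅a, b⁆ (i - 1) =
        if 3 ≤ i - 1 then coord a 1 * coord b (i - 1 - 1) - coord a (i - 1 - 1) * coord b 1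
        else 0 := by
      intro a b
      rw [coord_lie, if_pos (by omega)]
      unfold bracketCoord
      rw [if_neg (by omega)]
    simp only [coord_lie_one, key]
    split_ifs <;> ring
  · simp

instance instLieRing (R : Type*) [CommRing R] (n : ℕ) : LieRing (QAlg R n) where
  add_lie x y z := by
    apply ext_coord
    intro i hi hi'
    simp only [coord_add, coord_lie, hi, hi', and_self, if_true, bracketCoord]
    split_ifs
    · rw [← Finset.sum_add_distrib]
      exact Finset.sum_congr rfl fun k _ => by ring
    · ring
    · simp
  lie_add x y z := by
    apply ext_coord
    intro i hi hi'
    simp only [coord_add, coord_lie, hi, hi', and_self, if_true, bracketCoord]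
    split_ifs
    · rw [← Finset.sum_add_distrib]
      exact Finset.sum_congr rfl fun k _ => by ring
    · ring
    · simp
  lie_self x := by
    apply ext_coord
    intro i hi hi'
    rw [coord_lie, coord_zero, if_pos ⟨hi, hi'⟩]
    unfold bracketCoord
    split_ifs with h
    · refine Finset.sum_involution (fun k _ => 2 * n + 1 - k) ?_ ?_ ?_ ?_
      · intro k hk
        simp only [Finset.mem_Icc] at hk
        have h1 : 2 * n + 1 - (2 * n + 1 - k) = k := by omega
        have h2 : (-1 : R) ^ (2 * n + 1 - k) = - (-1) ^ k := by
          rcases Nat.even_or_odd k with h | h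
          · rw [h.neg_one_pow, Odd.neg_one_pow]
            rw [Nat.odd_sub (by omega)]; simp [h]
          · rw [h.neg_one_pow, Even.neg_one_pow (by rw [Nat.even_sub (by omega)]; simp [h])]
            ring
        rw [h1, h2]; ring
      · intro k hk _
        simp only [Finset.mem_Icc] at hk
        omega
      · intro k hk; simp only [Finset.mem_Icc] at hk ⊢; omega
      · intro k hk; simp only [Finset.mem_Icc] at hk; omega
    · ring
    · rfl
  leibniz_lie := lie_leibniz

instance instLieAlgebra (R : Type*) [CommRing R] (n : ℕ) : LieAlgebra R (QAlg R n) where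
  lie_smul c x y := by
    apply ext_coord
    intro i hi hi'
    simp only [coord_smul, coord_lie, hi, hi', and_self, if_true, bracketCoord]
    split_ifs
    · rw [Finset.mul_sum]
      exact Finset.sum_congr rfl fun k _ => by ring
    · ring
    · simp

theorem coord_X {R : Type*} [CommRing R] {n : ℕ} (i m : ℕ) (hi : 1 ≤ i) (hi' : i ≤ 2 * n) :
    coord (X R n i) m = if m = i then 1 else 0 := by
  unfold X
  rw [coord_ofCoord]
  split_ifs <;> first | rfl | omega

/-- The relations `[X_1, X_i] = X_{i+1}`, `2 ≤ i ≤ 2n - 2`. -/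
theorem lie_X_one {R : Type*} [CommRing R] {n i : ℕ} (h2 : 2 ≤ i) (hi : i ≤ 2 * n - 2) :
    ⁅X R n 1, X R n i⁆ = X R n (i + 1) := by
  apply ext_coord
  intro m hm hm'
  rw [coord_lie, if_pos ⟨hm, hm'⟩, coord_X (i + 1) m (by omega) (by omega)]
  unfold bracketCoord
  simp only [coord_X (R := R) (n := n) 1 _ le_rfl (by omega),
    coord_X (R := R) (n := n) i _ (by omega) (by omega)]
  split_ifs with h1 h3 h4
  · omega
  · refine Finset.sum_eq_zero fun k hk => ?_
    simp only [Finset.mem_Icc] at hk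
    rw [if_neg (show ¬ k = 1 by omega)]; ring
  all_goals first | omega | simp

/-- The relations `[X_k, X_{2n+1-k}] = (-1)^k X_{2n}`, `2 ≤ k ≤ n`. -/
theorem lie_X_dual {R : Type*} [CommRing R] {n k : ℕ} (h2 : 2 ≤ k) (hk : k ≤ n) :
    ⁅X R n k, X R n (2 * n + 1 - k)⁆ = (-1 : R) ^ k • X R n (2 * n) := by
  apply ext_coord
  intro m hm hm'
  rw [coord_lie, if_pos ⟨hm, hm'⟩, coord_smul, coord_X (2 * n) m (by omega) le_rfl]
  unfold bracketCoord
  simp only [coord_X (R := R) (n := n) k _ (by omega) (by omega),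
    coord_X (R := R) (n := n) (2 * n + 1 - k) _ (by omega) (by omega)]
  by_cases h1 : m = 2 * n
  · rw [if_pos h1, if_pos h1, Finset.sum_eq_single k]
    · simp
    · intro j _ hjk
      simp [hjk]
    · intro h
      exact absurd (Finset.mem_Icc.mpr ⟨h2, by omega⟩) h
  · rw [if_neg h1, if_neg h1, if_neg (show ¬ 1 = k by omega),
      if_neg (show ¬ 1 = 2 * n + 1 - k by omega)]
    simp

/-- All other brackets `[X_i, X_j]` with `i < j` vanish. -/
theorem lie_X_other {R : Type*} [CommRing R] {n i j : ℕ} (hi : 1 ≤ i) (hij : i < j)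
    (hj : j ≤ 2 * n) (h1 : i = 1 → 2 * n - 2 < j) (h2 : 2 ≤ i → i + j ≠ 2 * n + 1) :
    ⁅X R n i, X R n j⁆ = 0 := by
  apply ext_coord
  intro m hm hm'
  rw [coord_lie, if_pos ⟨hm, hm'⟩, coord_zero]
  unfold bracketCoord
  simp only [coord_X (R := R) (n := n) i _ hi (by omega),
    coord_X (R := R) (n := n) j _ (by omega) hj]
  split_ifs with h3
  · refine Finset.sum_eq_zero fun k hk => ?_
    simp only [Finset.mem_Icc] at hk
    by_cases hki : k = i
    · rw [if_neg (show ¬ 2 * n + 1 - k = j by omega)]; ring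
    · rw [if_neg hki]; ring
  all_goals first | omega | simp

end QAlg

/-- The nilradical of a Lie algebra: the largest ideal that is nilpotent as a Lie algebra.
(Mathlib's `LieAlgebra.maxNilpotentIdeal` is a different ideal: it is the largest ideal on which
the whole of `L` acts nilpotently, i.e. the hypercentre.) -/
def nilradicalIdeal (R L : Type*) [CommRing R] [LieRing L] [LieAlgebra R L] : LieIdeal R L :=
  sSup {I : LieIdeal R L | LieRing.IsNilpotent I}

/-- A finite family of derivations is nil-independent if no nontrivial linear combination of its
members is a nilpotent endomorphism. -/
def NilIndependent {R L ι : Type*} [CommRing R] [LieRing L] [LieAlgebra R L] [Fintype ι]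
    (D : ι → LieDerivation R L L) : Prop :=
  ∀ c : ι → R, IsNilpotent (∑ i, c i • (D i : L →ₗ[R] L)) → ∀ i, c i = 0

/-! Two scalars control each derivation D: the coefficient a of `X_1` in `D X_1` and the coefficient
b of `X_2` in `D X_2`. Every `X_k` with k ≥ 3 is a bracket, so by Leibniz a = b = 0 forces D to be
strictly triangular in the given basis, hence nilpotent (`isNilpotent_of_diagonal_eq_zero`). The
linear map `diagonal : D ↦ (a, b)` thus sends nil-independent families to linearly independent ones
in a plane, which gives the bound 2.

For the dimension of r, let r act on its nilradical and compose with `diagonal`. The resulting map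
from r to the plane kills brackets (`diagonal_lie`), so its kernel is an ideal, and it acts
nilpotently on the nilradical. By solvability it lies inside the nilradical (`le_nilradicalIdeal`),
whence dim r ≤ 2n + 2. If dim r were 2n, r would equal its nilradical and be nilpotent. -/

namespace QAlg

/-! ### Coordinates and triangular endomorphisms. -/

section Derivations

variable {R : Type*} [CommRing R] {n : ℕ}

theorem coord_lie_two (hn : 2 ≤ n) (x y : QAlg R n) : coord ⁅x, y⁆ 2 = 0 := by
  rw [coord_lie]
  split_ifs
  · unfold bracketCoord
    rw [if_neg (by omega), if_neg (by omega)]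
  · rfl

theorem coord_lie_of_lt {m : ℕ} (hm : 3 ≤ m) (hm' : m < 2 * n) (x y : QAlg R n) :
    coord ⁅x, y⁆ m = coord x 1 * coord y (m - 1) - coord x (m - 1) * coord y 1 := by
  rw [coord_lie, if_pos (by omega)]
  unfold bracketCoord
  rw [if_neg (by omega), if_pos hm]

theorem coord_lie_two_mul (hn : 1 ≤ n) (x y : QAlg R n) :
    coord ⁅x, y⁆ (2 * n) =
      ∑ k ∈ Finset.Icc 2 (2 * n - 1), (-1) ^ k * (coord x k * coord y (2 * n + 1 - k)) := by
  rw [coord_lie, if_pos (by omega)]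
  unfold bracketCoord
  rw [if_pos rfl]

theorem eq_sum_coord_smul_X (x : QAlg R n) :
    x = ∑ j ∈ Finset.Icc 1 (2 * n), coord x j • X R n j := by
  have coord_sum : ∀ (s : Finset ℕ) (f : ℕ → QAlg R n) (i : ℕ),
      coord (∑ j ∈ s, f j) i = ∑ j ∈ s, coord (f j) i := fun s f i =>
    map_sum (AddMonoidHom.mk' (fun y : QAlg R n => coord y i) fun y z => coord_add y z i) f s
  apply ext_coord
  intro i hi hi'
  rw [coord_sum, Finset.sum_eq_single i]
  · rw [coord_smul, coord_X i i hi hi', if_pos rfl, mul_one]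
  · intro j hj hji
    rw [Finset.mem_Icc] at hj
    rw [coord_smul, coord_X j i hj.1 hj.2, if_neg hji.symm, mul_zero]
  · intro h
    exact absurd (Finset.mem_Icc.mpr ⟨hi, hi'⟩) h

/-- The coordinate functional `x ↦ x_i`. -/
def coordLinear (R : Type*) [CommRing R] (n i : ℕ) : QAlg R n →ₗ[R] R where
  toFun x := coord x i
  map_add' x y := coord_add x y i
  map_smul' c x := coord_smul c x i

theorem coord_map (f : QAlg R n →ₗ[R] QAlg R n) (x : QAlg R n) (i : ℕ) :
    coord (f x) i = ∑ j ∈ Finset.Icc 1 (2 * n), coord x j * coord (f (X R n j)) i := by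
  change ((coordLinear R n i) ∘ₗ f) x = _
  conv_lhs => rw [eq_sum_coord_smul_X x]
  rw [map_sum]
  exact Finset.sum_congr rfl fun j _ => by rw [map_smul]; rfl

/-- Each application of `f` kills one more leading coordinate, so `f ^ (2 * n) = 0`. -/
theorem isNilpotent_of_strictly_triangular (f : QAlg R n →ₗ[R] QAlg R n)
    (hf : ∀ j, 1 ≤ j → j ≤ 2 * n → ∀ i ≤ j, coord (f (X R n j)) i = 0) : IsNilpotent f := by
  have key : ∀ k x, ∀ i ≤ k, coord ((f ^ k) x) i = 0 := by
    intro k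
    induction k with
    | zero =>
      intro x i hi
      unfold coord
      rw [dif_neg (by omega)]
    | succ k ih =>
      intro x i hi
      rw [pow_succ', Module.End.mul_apply, coord_map]
      refine Finset.sum_eq_zero fun j hj => ?_
      rw [Finset.mem_Icc] at hj
      rcases le_or_gt j k with h | h
      · rw [ih x j h, zero_mul]
      · rw [hf j hj.1 hj.2 i (by omega), mul_zero]
  refine ⟨2 * n, LinearMap.ext fun x => ext_coord fun i _ hi => ?_⟩
  rw [key _ x i hi, LinearMap.zero_apply, coord_zero]

theorem X_two_mul_eq_lie (hn : 2 ≤ n) : X R n (2 * n) = ⁅X R n 2, X R n (2 * n - 1)⁆ := by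
  have h := lie_X_dual (R := R) (n := n) (k := 2) le_rfl hn
  rw [show 2 * n + 1 - 2 = 2 * n - 1 by omega] at h
  rw [h]
  simp

theorem exists_X_eq_lie (hn : 2 ≤ n) {k : ℕ} (hk : 3 ≤ k) (hk' : k ≤ 2 * n) :
    ∃ x y : QAlg R n, X R n k = ⁅x, y⁆ := by
  rcases hk'.eq_or_lt with rfl | h
  · exact ⟨_, _, X_two_mul_eq_lie hn⟩
  · refine ⟨X R n 1, X R n (k - 1), ?_⟩
    rw [lie_X_one (by omega) (by omega), show k - 1 + 1 = k by omega]

/-! ### Triangular form of derivations and their diagonal. -/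

variable (D : LieDerivation R (QAlg R n) (QAlg R n))

/-- Leibniz turns D of a bracket into a sum of brackets, and these have no `X_1` component. -/
theorem coord_derivation_X_one (hn : 2 ≤ n) {k : ℕ} (hk : 3 ≤ k) (hk' : k ≤ 2 * n) :
    coord (D (X R n k)) 1 = 0 := by
  obtain ⟨x, y, h⟩ := exists_X_eq_lie (R := R) hn hk hk'
  rw [h, LieDerivation.apply_lie_eq_add, coord_add, coord_lie_one, coord_lie_one, add_zero]

theorem coord_derivation_X_two (hn : 2 ≤ n) {k : ℕ} (hk : 3 ≤ k) (hk' : k ≤ 2 * n) :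
    coord (D (X R n k)) 2 = 0 := by
  obtain ⟨x, y, h⟩ := exists_X_eq_lie (R := R) hn hk hk'
  rw [h, LieDerivation.apply_lie_eq_add, coord_add, coord_lie_two hn, coord_lie_two hn, add_zero]

/-- Apply D to `[X_2, X_3] = 0` and read off `X_4`: only `[D X_2, X_3]` contributes. Here n ≥ 3
ensures 4 < 2n. -/
theorem coord_derivation_X_two_one (hn : 3 ≤ n) : coord (D (X R n 2)) 1 = 0 := by
  have h : ⁅X R n 2, X R n 3⁆ = 0 :=
    lie_X_other (by omega) (by omega) (by omega) (by omega) (by omega)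
  have h2 := LieDerivation.apply_lie_eq_add D (X R n 2) (X R n 3)
  rw [h, map_zero] at h2
  have h3 := congrArg (fun z => coord z 4) h2
  simp only [coord_zero, coord_add] at h3
  rw [coord_lie_of_lt (by omega) (by omega), coord_lie_of_lt (by omega) (by omega),
    coord_X 2 1 (by omega) (by omega), coord_X 2 (4 - 1) (by omega) (by omega),
    coord_X 3 1 (by omega) (by omega), coord_X 3 (4 - 1) (by omega) (by omega)] at h3
  simpa using h3.symm

theorem coord_derivation_one (hn : 3 ≤ n) (x : QAlg R n) :
    coord (D x) 1 = coord x 1 * coord (D (X R n 1)) 1 := by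
  have h := coord_map (D : QAlg R n →ₗ[R] QAlg R n) x 1
  simp only [LieDerivation.coeFn_coe] at h
  rw [h, Finset.sum_eq_single 1]
  · intro j hj hj1
    rw [Finset.mem_Icc] at hj
    rcases (show j = 2 ∨ 3 ≤ j by omega) with rfl | h3
    · rw [coord_derivation_X_two_one D hn, mul_zero]
    · rw [coord_derivation_X_one D (by omega) h3 hj.2, mul_zero]
  · intro h
    exact absurd (Finset.mem_Icc.mpr ⟨le_rfl, by omega⟩) h

theorem coord_derivation_two (hn : 3 ≤ n) (x : QAlg R n) :
    coord (D x) 2 = coord x 1 * coord (D (X R n 1)) 2 + coord x 2 * coord (D (X R n 2)) 2 := by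
  have h := coord_map (D : QAlg R n →ₗ[R] QAlg R n) x 2
  simp only [LieDerivation.coeFn_coe] at h
  rw [h, ← Finset.sum_pair (f := fun j => coord x j * coord (D (X R n j)) 2) (show 1 ≠ 2 by omega)]
  symm
  refine Finset.sum_subset (fun j hj => ?_) fun j hj hj1 => ?_
  · simp only [Finset.mem_insert, Finset.mem_singleton] at hj
    rw [Finset.mem_Icc]
    omega
  · simp only [Finset.mem_insert, Finset.mem_singleton] at hj1
    rw [Finset.mem_Icc] at hj
    rw [coord_derivation_X_two D (by omega) (by omega) hj.2, mul_zero]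

/-- Induction along `X_{k+1} = [X_1, X_k]`: bracketing with `X_1` shifts the vanishing range of `D
X_k` by one, and `[D X_1, X_k]` contributes on the diagonal only through a = 0. -/
theorem coord_derivation_X_eq_zero (hn : 3 ≤ n) (h1 : coord (D (X R n 1)) 1 = 0)
    (h2 : coord (D (X R n 2)) 2 = 0) {k : ℕ} (hk : 2 ≤ k) (hk' : k ≤ 2 * n - 1) :
    ∀ i ≤ k, coord (D (X R n k)) i = 0 := by
  have coord_none : ∀ x : QAlg R n, coord x 0 = 0 := fun x => by
    unfold coord
    rw [dif_neg (by omega)]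
  induction k, hk using Nat.le_induction with
  | base =>
    intro i hi
    interval_cases i
    · exact coord_none _
    · exact coord_derivation_X_two_one D hn
    · exact h2
  | succ k hk ih =>
    intro i hi
    rcases (show i = 0 ∨ i = 1 ∨ i = 2 ∨ 3 ≤ i by omega) with rfl | rfl | rfl | h3
    · exact coord_none _
    · exact coord_derivation_X_one D (by omega) (by omega) (by omega)
    · exact coord_derivation_X_two D (by omega) (by omega) (by omega)
    · rw [← lie_X_one (R := R) hk (by omega), LieDerivation.apply_lie_eq_add, coord_add,
        coord_lie_of_lt h3 (by omega), coord_lie_of_lt h3 (by omega), h1,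
        ih (by omega) (i - 1) (by omega), ih (by omega) 1 (by omega),
        coord_X k 1 (by omega) (by omega), if_neg (by omega)]
      ring

theorem coord_derivation_X_two_mul_eq_zero (hn : 3 ≤ n) (h1 : coord (D (X R n 1)) 1 = 0)
    (h2 : coord (D (X R n 2)) 2 = 0) {i : ℕ} (hi : i ≤ 2 * n) :
    coord (D (X R n (2 * n))) i = 0 := by
  rcases (show i = 0 ∨ i = 1 ∨ i = 2 ∨ 3 ≤ i by omega) with rfl | rfl | rfl | h3
  · unfold coord
    rw [dif_neg (by omega)]
  · exact coord_derivation_X_one D (by omega) (by omega) le_rfl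
  · exact coord_derivation_X_two D (by omega) (by omega) le_rfl
  rw [X_two_mul_eq_lie (by omega), LieDerivation.apply_lie_eq_add, coord_add]
  have hlast := coord_derivation_X_eq_zero D hn h1 h2 (k := 2 * n - 1) (by omega) le_rfl
  rcases hi.eq_or_lt with rfl | hlt
  -- The sum for `[X_2, D X_{2n-1}]` meets only vanishing coordinates of `D X_{2n-1}`; that for `[D
  -- X_2, X_{2n-1}]` reduces to k = 2, with factor b = 0.
  · rw [coord_lie_two_mul (by omega), coord_lie_two_mul (by omega),
      Finset.sum_eq_zero, Finset.sum_eq_zero, add_zero]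
    · intro k hk
      rw [Finset.mem_Icc] at hk
      rcases hk.1.eq_or_lt with rfl | hk2
      · rw [h2]
        ring
      · rw [coord_X (2 * n - 1) _ (by omega) (by omega), if_neg (by omega)]
        ring
    · intro k hk
      rw [Finset.mem_Icc] at hk
      rw [hlast _ (by omega)]
      ring
  · rw [coord_lie_of_lt h3 hlt, coord_lie_of_lt h3 hlt, hlast 1 (by omega),
      coord_derivation_X_two_one D hn, coord_X 2 1 (by omega) (by omega),
      coord_X (2 * n - 1) 1 (by omega) (by omega), if_neg (by omega), if_neg (by omega)]
    ring

/-- The diagonal entries at `X_1` and `X_2` of a derivation, which determine its diagonal. -/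
def diagonal (R : Type*) [CommRing R] (n : ℕ) :
    LieDerivation R (QAlg R n) (QAlg R n) →ₗ[R] R × R where
  toFun D := (coord (D (X R n 1)) 1, coord (D (X R n 2)) 2)
  map_add' D E := by simp [coord_add]
  map_smul' c D := by simp [coord_smul]

theorem isNilpotent_of_diagonal_eq_zero (hn : 3 ≤ n) (h : diagonal R n D = 0) :
    IsNilpotent (D : QAlg R n →ₗ[R] QAlg R n) := by
  have h1 : coord (D (X R n 1)) 1 = 0 := congrArg Prod.fst h
  have h2 : coord (D (X R n 2)) 2 = 0 := congrArg Prod.snd h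
  refine isNilpotent_of_strictly_triangular _ fun j hj hj' i hij => ?_
  rw [LieDerivation.coeFn_coe]
  rcases (show j = 1 ∨ j = 2 * n ∨ 2 ≤ j ∧ j ≤ 2 * n - 1 by omega) with rfl | rfl | ⟨ha, hb⟩
  · interval_cases i
    · unfold coord
      rw [dif_neg (by omega)]
    · exact h1
  · exact coord_derivation_X_two_mul_eq_zero D hn h1 h2 hij
  · exact coord_derivation_X_eq_zero D hn h1 h2 ha hb i hij

/-- Rows 1 and 2 of a derivation are supported on a triangular 2 × 2 block, and a commutator of
triangular matrices has zero diagonal. -/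
theorem diagonal_lie (hn : 3 ≤ n) (D E : LieDerivation R (QAlg R n) (QAlg R n)) :
    diagonal R n ⁅D, E⁆ = 0 := by
  have coord_sub : ∀ (x y : QAlg R n) (i : ℕ), coord (x - y) i = coord x i - coord y i :=
    fun x y i => map_sub (coordLinear R n i) x y
  refine Prod.ext ?_ ?_
  · change coord (⁅D, E⁆ (X R n 1)) 1 = 0
    rw [LieDerivation.lie_apply, coord_sub, coord_derivation_one D hn,
      coord_derivation_one E hn (D _)]
    ring
  · change coord (⁅D, E⁆ (X R n 2)) 2 = 0
    rw [LieDerivation.lie_apply, coord_sub, coord_derivation_two D hn,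
      coord_derivation_two E hn (D _), coord_derivation_X_two_one D hn,
      coord_derivation_X_two_one E hn]
    ring

theorem diagonal_ad (hn : 2 ≤ n) (x : QAlg R n) :
    diagonal R n (LieDerivation.ad R (QAlg R n) x) = 0 := by
  refine Prod.ext ?_ ?_
  · change coord (LieDerivation.ad R (QAlg R n) x (X R n 1)) 1 = 0
    rw [LieDerivation.ad_apply_apply]
    exact coord_lie_one _ _
  · change coord (LieDerivation.ad R (QAlg R n) x (X R n 2)) 2 = 0
    rw [LieDerivation.ad_apply_apply]
    exact coord_lie_two hn _ _

/-- Engel's theorem: inner derivations have zero diagonal. -/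
theorem lieRing_isNilpotent (R : Type*) [CommRing R] [IsNoetherianRing R] (hn : 3 ≤ n) :
    LieRing.IsNilpotent (QAlg R n) := by
  have : IsNoetherian R (QAlg R n) := inferInstanceAs (IsNoetherian R (Fin (2 * n) → R))
  rw [LieAlgebra.isNilpotent_iff_forall (R := R)]
  intro x
  have h := isNilpotent_of_diagonal_eq_zero _ hn (diagonal_ad (by omega) x)
  rwa [LieDerivation.coe_ad_apply_eq_ad_apply] at h

theorem finrank_eq (R : Type*) [CommRing R] [StrongRankCondition R] (n : ℕ) :
    Module.finrank R (QAlg R n) = 2 * n := by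
  rw [Module.finrank_eq_card_basis (basis R n), Fintype.card_fin]

theorem card_le_two_of_nilIndependent {K : Type*} [Field K] (hn : 3 ≤ n) {m : ℕ}
    (D : Fin m → LieDerivation K (QAlg K n) (QAlg K n)) (hD : NilIndependent D) : m ≤ 2 := by
  have hli : LinearIndependent K fun i => diagonal K n (D i) := by
    rw [Fintype.linearIndependent_iff]
    intro c hc
    apply hD c
    have h0 : diagonal K n (∑ i, c i • D i) = 0 := by
      rw [map_sum, ← hc]
      exact Finset.sum_congr rfl fun i _ => map_smul _ _ _
    convert isNilpotent_of_diagonal_eq_zero _ hn h0 using 1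
    ext x
    have hs : (∑ i, c i • D i) x = ∑ i, (c i • D i) x :=
      map_sum (AddMonoidHom.mk' (fun E : LieDerivation K (QAlg K n) (QAlg K n) => E x)
        fun _ _ => rfl) _ _
    rw [LieDerivation.coeFn_coe, hs, LinearMap.sum_apply]
    rfl
  simpa using hli.fintype_card_le_finrank

end Derivations

end QAlg

/-! ### Ideals acting nilpotently on the nilradical. -/

section Ideals

variable {R L N : Type*} [CommRing R] [LieRing L] [LieAlgebra R L] [LieRing N] [LieAlgebra R N]

/-- The action of a Lie algebra by derivations on an isomorphic copy of one of its ideals. -/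
def LieIdeal.derivationOfEquiv (I : LieIdeal R L) (e : I ≃ₗ⁅R⁆ N) :
    L →ₗ[R] LieDerivation R N N where
  toFun x :=
    { toFun := fun v => e ⁅x, e.symm v⁆
      map_add' := fun v w => by rw [map_add, lie_add, map_add]
      map_smul' := fun c v => by rw [map_smul, lie_smul, map_smul, RingHom.id_apply]
      leibniz' := fun v w => by
        have h : ∀ p q : I, ⁅x, ⁅p, q⁆⁆ = ⁅p, ⁅x, q⁆⁆ - ⁅q, ⁅x, p⁆⁆ := fun p q =>
          Subtype.ext (by
            change ⁅x, ⁅(p : L), (q : L)⁆⁆ = ⁅(p : L), ⁅x, (q : L)⁆⁆ - ⁅(q : L), ⁅x, (p : L)⁆⁆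
            rw [leibniz_lie x, ← lie_skew ⁅x, (p : L)⁆]
            abel)
        change e ⁅x, e.symm ⁅v, w⁆⁆ = ⁅v, e ⁅x, e.symm w⁆⁆ - ⁅w, e ⁅x, e.symm v⁆⁆
        rw [LieEquiv.map_lie, h, map_sub, LieEquiv.map_lie, LieEquiv.map_lie,
          LieEquiv.apply_symm_apply, LieEquiv.apply_symm_apply] }
  map_add' x y := by
    ext v
    change e ⁅x + y, e.symm v⁆ = e ⁅x, e.symm v⁆ + e ⁅y, e.symm v⁆
    rw [add_lie, map_add]
  map_smul' c x := by
    ext v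
    change e ⁅c • x, e.symm v⁆ = c • e ⁅x, e.symm v⁆
    rw [smul_lie, map_smul]

theorem LieIdeal.derivationOfEquiv_apply (I : LieIdeal R L) (e : I ≃ₗ⁅R⁆ N) (x : L) (v : N) :
    I.derivationOfEquiv e x v = e ⁅x, e.symm v⁆ := rfl

theorem LieIdeal.derivationOfEquiv_lie (I : LieIdeal R L) (e : I ≃ₗ⁅R⁆ N) (x y : L) :
    I.derivationOfEquiv e ⁅x, y⁆ = ⁅I.derivationOfEquiv e x, I.derivationOfEquiv e y⁆ := by
  ext v
  simp only [LieDerivation.lie_apply, derivationOfEquiv_apply, LieEquiv.symm_apply_apply]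
  rw [lie_lie, map_sub]

theorem LieIdeal.isNilpotent_toEnd_of_derivationOfEquiv (I : LieIdeal R L) (e : I ≃ₗ⁅R⁆ N) {x : L}
    (h : IsNilpotent (I.derivationOfEquiv e x : N →ₗ[R] N)) :
    IsNilpotent (LieModule.toEnd R L I x) := by
  obtain ⟨k, hk⟩ := h
  have hpow : ∀ (j : ℕ) (v : I), e ((LieModule.toEnd R L I x ^ j) v) =
      ((I.derivationOfEquiv e x : N →ₗ[R] N) ^ j) (e v) := by
    intro j
    induction j with
    | zero => intro v; rfl
    | succ j ih =>
      intro v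
      rw [pow_succ', pow_succ', Module.End.mul_apply, Module.End.mul_apply, ← ih,
        LieDerivation.coeFn_coe, derivationOfEquiv_apply, LieEquiv.symm_apply_apply]
      rfl
  refine ⟨k, LinearMap.ext fun v => e.injective ?_⟩
  refine (hpow k v).trans ?_
  rw [hk, LinearMap.zero_apply, LinearMap.zero_apply]
  exact (map_zero e).symm

/-- An ideal whose derived ideal lies in `N` and which acts nilpotently on `N` is nilpotent. -/
theorem LieIdeal.isNilpotent_of_lie_le [IsNoetherian R L] {I N : LieIdeal R L} (hIN : ⁅I, I⁆ ≤ N)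
    (h : ∀ x ∈ I, IsNilpotent (LieModule.toEnd R L N x)) : LieRing.IsNilpotent I := by
  rw [LieAlgebra.isNilpotent_iff_forall (R := R)]
  rintro ⟨x, hx⟩
  obtain ⟨k, hk⟩ := h x hx
  -- The first application of `ad x` lands in `N`, where x acts nilpotently; hence the exponent j +
  -- 1. Engel then applies.
  have hpow : ∀ (j : ℕ) (y : I), (((LieAlgebra.ad R I ⟨x, hx⟩ ^ (j + 1)) y : I) : L) =
      ((LieModule.toEnd R L N x ^ j) ⟨⁅x, (y : L)⁆,
        hIN (LieSubmodule.lie_mem_lie hx y.2)⟩ : N) := by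
    intro j
    induction j with
    | zero => intro y; rw [pow_zero, zero_add, pow_one]; rfl
    | succ j ih =>
      intro y
      rw [pow_succ', Module.End.mul_apply, pow_succ' (LieModule.toEnd R L N x),
        Module.End.mul_apply]
      change ⁅x, (((LieAlgebra.ad R I ⟨x, hx⟩ ^ (j + 1)) y : I) : L)⁆ = _
      rw [ih]
      rfl
  refine ⟨k + 1, LinearMap.ext fun y => Subtype.ext ?_⟩
  rw [hpow, hk]
  rfl

/-- In a solvable Lie algebra, an ideal acting nilpotently on the nilradical lies in it. -/
theorem le_nilradicalIdeal [IsNoetherian R L] [LieAlgebra.IsSolvable L] (I : LieIdeal R L)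
    (h : ∀ x ∈ I, IsNilpotent (LieModule.toEnd R L (nilradicalIdeal R L) x)) :
    I ≤ nilradicalIdeal R L := by
  -- Some derived ideal of `I` is zero, hence in the nilradical. Climb back up the series: when one
  -- term lies there, the previous term is a nilpotent ideal, so it lies there too.
  obtain ⟨k, hk⟩ := (LieAlgebra.isSolvable_iff R L).mp inferInstance
  have hk' : LieAlgebra.derivedSeriesOfIdeal R L k I ≤ nilradicalIdeal R L :=
    (LieAlgebra.derivedSeriesOfIdeal_mono le_top k).trans (hk.le.trans bot_le)
  clear hk
  induction k with
  | zero => exact hk'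
  | succ k ih =>
    rw [LieAlgebra.derivedSeriesOfIdeal_succ] at hk'
    exact ih (le_sSup (LieIdeal.isNilpotent_of_lie_le hk' fun x hx =>
      h x (LieAlgebra.derivedSeriesOfIdeal_le_self I k hx)))

end Ideals

/-! ### Dimension bounds for the solvable extension. -/

section SolvableExtension

variable {K r : Type*} [Field K] [LieRing r] [LieAlgebra K r] [FiniteDimensional K r] {n : ℕ}

theorem finrank_le_of_nilradicalIdeal_equiv [LieAlgebra.IsSolvable r] (hn : 3 ≤ n)
    (e : nilradicalIdeal K r ≃ₗ⁅K⁆ QAlg K n) : Module.finrank K r ≤ 2 * n + 2 := by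
  let φ : r →ₗ[K] K × K := QAlg.diagonal K n ∘ₗ (nilradicalIdeal K r).derivationOfEquiv e
  -- `φ` vanishes on all brackets, so its kernel is an ideal.
  let I : LieIdeal K r :=
    { LinearMap.ker φ with
      lie_mem := fun {x y} _ => by
        change QAlg.diagonal K n ((nilradicalIdeal K r).derivationOfEquiv e ⁅x, y⁆) = 0
        rw [LieIdeal.derivationOfEquiv_lie, QAlg.diagonal_lie hn] }
  have hI : I ≤ nilradicalIdeal K r := le_nilradicalIdeal I fun x hx =>
    LieIdeal.isNilpotent_toEnd_of_derivationOfEquiv _ e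
      (QAlg.isNilpotent_of_diagonal_eq_zero _ hn hx)
  have hker : Module.finrank K (LinearMap.ker φ) ≤ 2 * n := by
    rw [← QAlg.finrank_eq K n, ← e.toLinearEquiv.finrank_eq]
    exact Submodule.finrank_mono (t := (nilradicalIdeal K r).toSubmodule) hI
  have hrange : Module.finrank K (LinearMap.range φ) ≤ 2 :=
    (Submodule.finrank_le _).trans (by simp)
  have := φ.finrank_range_add_finrank_ker
  omega

theorem lt_finrank_of_nilradicalIdeal_equiv (hr : ¬ LieRing.IsNilpotent r) (hn : 3 ≤ n)
    (e : nilradicalIdeal K r ≃ₗ⁅K⁆ QAlg K n) : 2 * n < Module.finrank K r := by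
  have hfin : Module.finrank K (nilradicalIdeal K r).toSubmodule = 2 * n := by
    rw [← QAlg.finrank_eq K n]
    exact e.toLinearEquiv.finrank_eq
  refine lt_of_le_of_ne (hfin ▸ Submodule.finrank_le _) fun h => hr ?_
  have htop : nilradicalIdeal K r = ⊤ := by
    rw [← LieSubmodule.toSubmodule_eq_top]
    exact Submodule.eq_top_of_finrank_eq (hfin.trans h)
  have hQ := QAlg.lieRing_isNilpotent K hn
  rw [← LieEquiv.nilpotent_iff_equiv_nilpotent e, htop] at hQ
  exact (LieEquiv.nilpotent_iff_equiv_nilpotent (LieIdeal.topEquiv (R := K) (L := r))).mp hQ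

end SolvableExtension

theorem proposition4 (𝕜 : Type*) [RCLike 𝕜] (n : ℕ) (hn : 3 ≤ n) :
    (∀ (r : Type*) [LieRing r] [LieAlgebra 𝕜 r] [FiniteDimensional 𝕜 r],
      LieAlgebra.IsSolvable r → ¬ LieRing.IsNilpotent r →
      Nonempty (nilradicalIdeal 𝕜 r ≃ₗ⁅𝕜⁆ QAlg 𝕜 n) →
      Module.finrank 𝕜 r = 2 * n + 1 ∨ Module.finrank 𝕜 r = 2 * n + 2) ∧
    (∀ (m : ℕ) (D : Fin m → LieDerivation 𝕜 (QAlg 𝕜 n) (QAlg 𝕜 n)),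
      NilIndependent D → m ≤ 2) := by
  refine ⟨fun r _ _ _ _ hr ⟨e⟩ => ?_, fun m D hD => QAlg.card_le_two_of_nilIndependent hn D hD⟩
  have h1 := lt_finrank_of_nilradicalIdeal_equiv hr hn e
  have h2 := finrank_le_of_nilradicalIdeal_equiv hn e
  omega
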